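/- All varieties are over $\mathbb{C}$. For $n\ge 0$ the bounded flag variety $BF_n$ is the variety of tuples of lines $(l_1,\dots,l_n)$ in $\mathbb{C}^{n+1}$ (with standard basis $e_0,\dots,e_n$) such that $l_k\subset l_{k-1}\oplus\mathbb{C}e_k$ for $k=1,\dots,n$, where $l_0:=\mathbb{C}e_0$. Since $l_k\subset\langle e_0,\dots,e_k\rangle$, it is a closed subvariety of $\prod_{k=1}^n\mathbb{P}^k$; write $z_k=[z_{k,0}:\dots:z_{k,k}]\in\mathbb{P}^k$ for the homogeneous coordinates of $l_k$ (and $z_{0,0}=1$). For $i,j\ge 0$ the generalised Buchstaber–Ray variety $BR_{i,j}$ is the hypersurface in $BF_i\times\mathbb{P}^j$ given by $$\sum_{k=0}^{\min\{i,j\}} z_{i,i-k}\,w_{j-k}=0,$$ where $[w_0:\dots:w_j]$ are the homogeneous coordinates on $\mathbb{P}^j$. A morphism of varieties $p:E\to B$ is called an algebraic fibre bundle with fibre $F$ if it is locally trivial in the Zariski topology, that is, every point of $B$ has a Zariski open neighbourhood $U\subset B$ with an isomorphism of varieties $p^{-1}(U)\cong U\times F$ over $U$. **Theorem.** (i) Let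 $j\ge 0$ and $i\ge j+1$. Then $$p:\ BR_{i,j}\to BF_{i-j-1},\qquad (z_1,\dots,z_i,w)\mapsto(z_1,\dots,z_{i-j-1}),$$ is an algebraic fibre bundle with fibre $BR_{j+1,j}$. (ii) Let $i\ge 1$. Then $$p_1:\ BR_{i,i}\to\mathbb{P}^1,\qquad (z_1,\dots,z_i,w)\mapsto z_1,$$ is an algebraic fibre bundle with fibre $BR_{i-1,i}$. -/

import Mathlib

namespace BuchstaberRay

open scoped LinearAlgebra.Projectivization Topology

/-- The product of complex projective spaces `∏ₐ ℙ^(d a)`; a point is a family of lines. -/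
abbrev MultiProj {ι : Type} (d : ι → ℕ) : Type :=
  ∀ a : ι, ℙ ℂ (Fin (d a + 1) → ℂ)

/-- Polynomials in the homogeneous coordinates of all the factors of `∏ₐ ℙ^(d a)`. -/
abbrev CoordPoly {ι : Type} (d : ι → ℕ) : Type :=
  MvPolynomial (Σ a : ι, Fin (d a + 1)) ℂ

/-- `P` is multihomogeneous of multidegree `e`: homogeneous of degree `e a` in the coordinates
of the `a`-th factor, for every `a`. -/
def IsMultihomogeneous {ι : Type} {d : ι → ℕ} (P : CoordPoly d) (e : ι →₀ ℕ) : Prop :=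
  MvPolynomial.IsWeightedHomogeneous
    (fun x : Σ a : ι, Fin (d a + 1) => Finsupp.single x.1 1) P e

/-- The value of `P` at (chosen) homogeneous coordinates of a point. For multihomogeneous `P` the
vanishing of this value does not depend on the choice, and the values of several `P` of one
multidegree depend on it only through a common nonzero factor. -/
noncomputable def evalAt {ι : Type} {d : ι → ℕ} (P : CoordPoly d) (x : MultiProj d) : ℂ :=
  MvPolynomial.eval (fun c => (x c.1).rep c.2) P

/-- The Zariski topology on `∏ₐ ℙ^(d a)`: the sets `{P ≠ 0}`, `P` multihomogeneous, are open and
generate the topology. -/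
@[reducible] def zariskiTopology {ι : Type} (d : ι → ℕ) : TopologicalSpace (MultiProj d) :=
  TopologicalSpace.generateFrom
    {U | ∃ (P : CoordPoly d) (e : ι →₀ ℕ), IsMultihomogeneous P e ∧ U = {x | evalAt P x ≠ 0}}

/-- Morphisms (regular maps) between subvarieties `X`, `Y` of products of projective spaces: Zariski
locally on `X`, each component of the map is given in homogeneous coordinates by multihomogeneous
polynomials of one multidegree without common zeros. -/
def IsRegularMap {ι κ : Type} {d : ι → ℕ} {d' : κ → ℕ}
    {X : Set (MultiProj d)} {Y : Set (MultiProj d')} (f : X → Y) : Prop :=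
  ∀ (x : X) (b : κ), ∃ U : Set (MultiProj d), IsOpen[zariskiTopology d] U ∧ (x : MultiProj d) ∈ U ∧
    ∃ (e : ι →₀ ℕ) (P : Fin (d' b + 1) → CoordPoly d), (∀ c, IsMultihomogeneous (P c) e) ∧
      ∀ y : X, (y : MultiProj d) ∈ U →
        ∃ h : (fun c => evalAt (P c) y) ≠ 0,
          (f y : MultiProj d') b = Projectivization.mk ℂ (fun c => evalAt (P c) y) h

/-- First component of a point of a product of two multiprojective spaces. -/
def fstPt {ι κ : Type} {d : ι → ℕ} {d' : κ → ℕ} (x : MultiProj (Sum.elim d d')) : MultiProj d :=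
  fun a => x (Sum.inl a)

/-- Second component of a point of a product of two multiprojective spaces. -/
def sndPt {ι κ : Type} {d : ι → ℕ} {d' : κ → ℕ} (x : MultiProj (Sum.elim d d')) : MultiProj d' :=
  fun b => x (Sum.inr b)

/-- The product variety `X × Y`, inside the product of the ambient multiprojective spaces. -/
def prodVar {ι κ : Type} {d : ι → ℕ} {d' : κ → ℕ}
    (X : Set (MultiProj d)) (Y : Set (MultiProj d')) : Set (MultiProj (Sum.elim d d')) :=
  {x | fstPt x ∈ X ∧ sndPt x ∈ Y}

/-- The preimage `p⁻¹(U)` of `U ∩ B` under `p : E → B`, as a subset of the ambient space of `E`. -/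
def preimageVar {ι κ : Type} {d : ι → ℕ} {d' : κ → ℕ}
    {E : Set (MultiProj d)} {B : Set (MultiProj d')} (p : E → B) (U : Set (MultiProj d')) :
    Set (MultiProj d) :=
  {x | ∃ h : x ∈ E, (p ⟨x, h⟩ : MultiProj d') ∈ U}

/-- `p : E → B` is an algebraic fibre bundle with fibre `F`, locally trivial in the Zariski
topology: `p` is a morphism and every point of `B` has a Zariski open neighbourhood `U ∩ B` in `B`
with an isomorphism of varieties `p⁻¹(U) ≅ (U ∩ B) × F` over `U ∩ B`. -/
def IsZariskiFiberBundle {ι κ μ : Type} {d : ι → ℕ} {d' : κ → ℕ} {d'' : μ → ℕ}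
    {E : Set (MultiProj d)} {B : Set (MultiProj d')} (p : E → B) (F : Set (MultiProj d'')) :
    Prop :=
  IsRegularMap p ∧
    ∀ b : B, ∃ U : Set (MultiProj d'), IsOpen[zariskiTopology d'] U ∧ (b : MultiProj d') ∈ U ∧
      ∃ φ : preimageVar p U ≃ prodVar (B ∩ U) F,
        IsRegularMap φ ∧ IsRegularMap φ.symm ∧
          ∀ x : preimageVar p U, fstPt (φ x : MultiProj (Sum.elim d' d'')) = p ⟨x, x.2.1⟩

/-- The projective space `ℙ^n`, as a product with one factor. -/
def projSpace (n : ℕ) : Set (MultiProj (fun _ : Unit => n)) := Set.univ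

/-- The factors `ℙ^0, ℙ^1, …, ℙ^n` that contain the lines `l_0, l_1, …, l_n`. -/
abbrev bfDim (n : ℕ) : Fin (n + 1) → ℕ := fun k => k

/-- The bounded flag variety `BF_n ⊆ ℙ^1 × ⋯ × ℙ^n`: tuples of lines `l_k ⊆ ⟨e_0, …, e_k⟩` with
`l_{k+1} ⊆ l_k ⊕ ⟨e_{k+1}⟩`, that is, the rows `(z_{k+1,0}, …, z_{k+1,k})` and
`(z_{k,0}, …, z_{k,k})` have rank one: all their `2 × 2` minors vanish. The line
`l_0 = ⟨e_0⟩ ∈ ℙ^0` (a point) is kept as a component, with index `0`. -/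
def BF (n : ℕ) : Set (MultiProj (bfDim n)) :=
  {z | ∀ (k : Fin n) (a b : Fin ((k : ℕ) + 1)),
    (z k.succ).rep a.castSucc * (z k.castSucc).rep b =
      (z k.succ).rep b.castSucc * (z k.castSucc).rep a}

/-- The generalised Buchstaber–Ray variety: the hypersurface
`∑_{k=0}^{min(i,j)} z_{i,i-k} w_{j-k} = 0` in `BF_i × ℙ^j`. -/
def BR (i j : ℕ) : Set (MultiProj (Sum.elim (bfDim i) (fun _ : Unit => j))) :=
  {x | x ∈ prodVar (BF i) (projSpace j) ∧
    ∑ k : Fin (min i j + 1),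
      (fstPt x (Fin.last i)).rep ⟨i - k, Nat.lt_succ_of_le (Nat.sub_le _ _)⟩ *
        (sndPt x ()).rep ⟨j - k, Nat.lt_succ_of_le (Nat.sub_le _ _)⟩ = 0}

/-- Forgetting the lines with index greater than `m`: `BF_n → BF_m`, for `m ≤ n`. -/
def BF.forget {m n : ℕ} (h : m ≤ n) (z : BF n) : BF m :=
  ⟨fun k => z.1 (Fin.castLE (Nat.succ_le_succ h) k),
    fun k a b => z.2 (Fin.castLE h k) a b⟩

/-- The map `BR_{i,j} → BF_m`, `(z_1, …, z_i, w) ↦ (z_1, …, z_m)`, for `m ≤ i`. -/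
def BR.toBF {i j m : ℕ} (h : m ≤ i) (x : BR i j) : BF m :=
  BF.forget h ⟨fstPt x.1, x.2.1.1⟩

/-- The map `BR_{i,j} → ℙ^1`, `(z_1, …, z_i, w) ↦ z_1`, for `1 ≤ i`. -/
def BR.toLine {i j : ℕ} (h : 1 ≤ i) (x : BR i j) : projSpace 1 :=
  ⟨fun _ => fstPt x.1 ⟨1, Nat.lt_succ_of_le h⟩, Set.mem_univ _⟩

end BuchstaberRay

namespace BuchstaberRay

open scoped LinearAlgebra.Projectivization Topology

/-! ### Coordinate rows -/

/-! Fix the line `l_m` of a bounded flag, spanned by `b`. The later lines satisfy `l_{m+r} ⊂ l_m ⊕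
⟨e_{m+1}, …, e_{m+r}⟩`. Where `b_a ≠ 0`, the vector `b / b_a` and `e_{m+1}, e_{m+2}, …` form a basis
depending algebraically on `l_m`, and coordinates in it turn `(l_m, l_{m+1}, …)` into a bounded flag
of its own (`IsChain.fibRows`). Conversely, a flag ending in `l_m` and a flag of such coordinates
glue (`IsChain.glueRows`). It remains to follow the bilinear equation.

(i) Take `m = i - j - 1`. The equation involves only the entries `z_{i,t}` with `t > m`, which the
new basis leaves alone, so it becomes the equation of `BR_{j+1,j}` in the same `w`
(`pairing_fibRow`, `pairing_glueRow`).

(ii) Take `m = 1` and `j = i`. Now `w` is a linear form that must vanish on `l_i`. With `y` the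
fibre coordinates of `l_i`, scaled as in `glueRow`, the condition reads `y_0 w(b) + b_a (y_1 w_2 +
y_2 w_3 + ⋯) = 0`. New coordinates on the second factor with `u_1 = w(b)`, `u_s = b_a w_s` for `s ≥
2`, and the complementary `u_0 = b_a w_{1-a}`, turn this into `∑ y_s u_{s+1} = 0`, the equation of
`BR_{i-1,i}` (`pairing_adaptRow`).

Denominators are cleared throughout, so every formula is multihomogeneous and identities hold only
up to a nonzero factor; `RowEquiv` records this. -/

/-- The rows `v` and `w` are proportional, with a nonzero factor, in the entries `0, …, n`. -/
def RowEquiv (n : ℕ) (v w : ℕ → ℂ) : Prop :=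
  ∃ c : ℂ, c ≠ 0 ∧ ∀ s ≤ n, v s = c * w s

lemma RowEquiv.refl (n : ℕ) (v : ℕ → ℂ) : RowEquiv n v v :=
  ⟨1, one_ne_zero, fun _ _ => (one_mul _).symm⟩

lemma RowEquiv.symm {n : ℕ} {v w : ℕ → ℂ} (h : RowEquiv n v w) : RowEquiv n w v := by
  obtain ⟨c, hc, h⟩ := h
  exact ⟨c⁻¹, inv_ne_zero hc, fun s hs => by rw [h s hs, inv_mul_cancel_left₀ hc]⟩

lemma RowEquiv.trans {n : ℕ} {u v w : ℕ → ℂ} (h : RowEquiv n u v) (h' : RowEquiv n v w) :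
    RowEquiv n u w := by
  obtain ⟨c, hc, h⟩ := h
  obtain ⟨c', hc', h'⟩ := h'
  exact ⟨c * c', mul_ne_zero hc hc', fun s hs => by rw [h s hs, h' s hs, mul_assoc]⟩

lemma RowEquiv.exists_ne_zero {n : ℕ} {v w : ℕ → ℂ} (h : RowEquiv n v w)
    (hw : ∃ s ≤ n, w s ≠ 0) : ∃ s ≤ n, v s ≠ 0 := by
  obtain ⟨c, hc, h⟩ := h
  obtain ⟨s, hs, hw⟩ := hw
  exact ⟨s, hs, by rw [h s hs]; exact mul_ne_zero hc hw⟩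

/-- The homogeneous coordinates of a point of `ℙ^n`, extended by zero to all of `ℕ`. -/
noncomputable def hcoord {n : ℕ} (x : ℙ ℂ (Fin (n + 1) → ℂ)) (s : ℕ) : ℂ :=
  if h : s < n + 1 then x.rep ⟨s, h⟩ else 0

lemma hcoord_of_lt {n : ℕ} (x : ℙ ℂ (Fin (n + 1) → ℂ)) {s : ℕ} (h : s < n + 1) :
    hcoord x s = x.rep ⟨s, h⟩ := dif_pos h

lemma hcoord_fin {n : ℕ} (x : ℙ ℂ (Fin (n + 1) → ℂ)) (s : Fin (n + 1)) :
    hcoord x s = x.rep s := dif_pos s.2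

lemma exists_hcoord_ne_zero {n : ℕ} (x : ℙ ℂ (Fin (n + 1) → ℂ)) : ∃ s ≤ n, hcoord x s ≠ 0 := by
  obtain ⟨s, hs⟩ := Function.ne_iff.mp x.rep_nonzero
  exact ⟨s, Nat.lt_succ_iff.mp s.2, by rwa [hcoord_fin]⟩

lemma eq_mk_of_rowEquiv {n : ℕ} {x : ℙ ℂ (Fin (n + 1) → ℂ)} {v : ℕ → ℂ}
    (h : RowEquiv n v (hcoord x)) :
    ∃ hv : (fun s : Fin (n + 1) => v s) ≠ 0, x = Projectivization.mk ℂ _ hv := by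
  obtain ⟨t, ht, hne⟩ := h.exists_ne_zero (exists_hcoord_ne_zero x)
  refine ⟨fun h0 => hne (congrFun h0 ⟨t, Nat.lt_succ_iff.mpr ht⟩), ?_⟩
  obtain ⟨c, hc, h⟩ := h.symm
  conv_lhs => rw [← x.mk_rep]
  rw [Projectivization.mk_eq_mk_iff']
  refine ⟨c, funext fun s => ?_⟩
  rw [← hcoord_fin, h s (Nat.lt_succ_iff.mp s.2)]
  rfl

lemma eq_of_rowEquiv {n : ℕ} {x y : ℙ ℂ (Fin (n + 1) → ℂ)}
    (h : RowEquiv n (hcoord x) (hcoord y)) : x = y := by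
  obtain ⟨h₁, e₁⟩ := eq_mk_of_rowEquiv h
  obtain ⟨h₂, e₂⟩ := eq_mk_of_rowEquiv (RowEquiv.refl n (hcoord x))
  exact e₂.trans e₁.symm

/-- The point of `ℙ^n` with the homogeneous coordinates `v 0, …, v n` (any point, if they all
vanish). -/
noncomputable def ptOf (n : ℕ) (v : ℕ → ℂ) : ℙ ℂ (Fin (n + 1) → ℂ) :=
  if h : (fun s : Fin (n + 1) => v s) ≠ 0 then Projectivization.mk ℂ _ h
  else Projectivization.mk ℂ (fun _ => 1) (Function.ne_iff.mpr ⟨0, one_ne_zero⟩)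

lemma rowEquiv_hcoord_ptOf {n : ℕ} {v : ℕ → ℂ} (h : ∃ s ≤ n, v s ≠ 0) :
    RowEquiv n v (hcoord (ptOf n v)) := by
  obtain ⟨t, ht, hne⟩ := h
  have hv : (fun s : Fin (n + 1) => v s) ≠ 0 :=
    fun h0 => hne (congrFun h0 ⟨t, Nat.lt_succ_iff.mpr ht⟩)
  obtain ⟨c, hc⟩ := Projectivization.exists_smul_eq_mk_rep ℂ _ hv
  refine RowEquiv.symm ⟨c, c.ne_zero, fun s hs => ?_⟩
  rw [ptOf, dif_pos hv, hcoord_of_lt _ (Nat.lt_succ_iff.mpr hs), ← hc]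
  rfl

/-! ### Regular maps given by global formulas -/

/-- The homogeneous coordinate of index `s` on the factor `a`; zero if there is none. -/
noncomputable def coordVar {ι : Type} {d : ι → ℕ} (a : ι) (s : ℕ) : CoordPoly d :=
  if h : s < d a + 1 then MvPolynomial.X ⟨a, ⟨s, h⟩⟩ else 0

lemma isMultihomogeneous_coordVar {ι : Type} {d : ι → ℕ} (a : ι) (s : ℕ) :
    IsMultihomogeneous (coordVar a s : CoordPoly d) (Finsupp.single a 1) := by
  unfold coordVar
  split_ifs with h
  · exact MvPolynomial.isWeightedHomogeneous_X ℂ _ (⟨a, ⟨s, h⟩⟩ : Σ a : ι, Fin (d a + 1))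
  · exact MvPolynomial.isWeightedHomogeneous_zero ℂ _ _

lemma evalAt_coordVar {ι : Type} {d : ι → ℕ} (a : ι) (s : ℕ) (x : MultiProj d) :
    evalAt (coordVar a s) x = hcoord (x a) s := by
  unfold evalAt coordVar hcoord
  split_ifs <;> simp

lemma evalAt_mul {ι : Type} {d : ι → ℕ} (P Q : CoordPoly d) (x : MultiProj d) :
    evalAt (P * Q) x = evalAt P x * evalAt Q x := map_mul _ _ _

lemma evalAt_add {ι : Type} {d : ι → ℕ} (P Q : CoordPoly d) (x : MultiProj d) :
    evalAt (P + Q) x = evalAt P x + evalAt Q x := map_add _ _ _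

lemma evalAt_sub {ι : Type} {d : ι → ℕ} (P Q : CoordPoly d) (x : MultiProj d) :
    evalAt (P - Q) x = evalAt P x - evalAt Q x := map_sub _ _ _

lemma evalAt_one {ι : Type} {d : ι → ℕ} (x : MultiProj d) :
    evalAt (1 : CoordPoly d) x = 1 := map_one _

lemma isMultihomogeneous_coordVar_mul {ι : Type} {d : ι → ℕ} (a b : ι) (s t : ℕ) :
    IsMultihomogeneous (coordVar a s * coordVar b t : CoordPoly d)
      (Finsupp.single a 1 + Finsupp.single b 1) :=
  MvPolynomial.IsWeightedHomogeneous.mul (isMultihomogeneous_coordVar a s)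
    (isMultihomogeneous_coordVar b t)

lemma IsMultihomogeneous.sub {ι : Type} {d : ι → ℕ} {P Q : CoordPoly d} {e : ι →₀ ℕ}
    (hP : IsMultihomogeneous P e) (hQ : IsMultihomogeneous Q e) :
    IsMultihomogeneous (P - Q) e :=
  (MvPolynomial.weightedHomogeneousSubmodule ℂ _ e).sub_mem hP hQ

lemma isOpen_hcoord_ne_zero {ι : Type} {d : ι → ℕ} (a : ι) (s : ℕ) :
    IsOpen[zariskiTopology d] {x : MultiProj d | hcoord (x a) s ≠ 0} :=
  TopologicalSpace.isOpen_generateFrom_of_mem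
    ⟨coordVar a s, _, isMultihomogeneous_coordVar a s, by simp only [evalAt_coordVar]⟩

/-- The row `R x` is given by multihomogeneous polynomials of one multidegree in `x`. -/
def IsPolyRow {ι : Type} {d : ι → ℕ} (R : MultiProj d → ℕ → ℂ) : Prop :=
  ∃ (e : ι →₀ ℕ) (P : ℕ → CoordPoly d),
    (∀ s, IsMultihomogeneous (P s) e) ∧ ∀ x, (fun s => evalAt (P s) x) = R x

lemma isPolyRow_hcoord {ι : Type} {d : ι → ℕ} (a : ι) :
    IsPolyRow (fun x : MultiProj d => hcoord (x a)) :=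
  ⟨_, coordVar a, isMultihomogeneous_coordVar a, fun x => funext fun s => evalAt_coordVar a s x⟩

lemma isPolyRow_one {ι : Type} {d : ι → ℕ} : IsPolyRow (fun (_ : MultiProj d) _ => 1) :=
  ⟨0, 1, fun _ => MvPolynomial.isWeightedHomogeneous_one ℂ _, fun x => funext fun _ => evalAt_one x⟩

/-- The proportionality factor may vary with the point in any way, since only the spanned line
matters. This absorbs the arbitrary choice of representatives made by `rep`. -/
lemma isRegularMap_of_rowEquiv {ι κ : Type} {d : ι → ℕ} {d' : κ → ℕ}
    {X : Set (MultiProj d)} {Y : Set (MultiProj d')} {f : X → Y}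
    (hf : ∀ b : κ, ∃ R : MultiProj d → ℕ → ℂ, IsPolyRow R ∧
      ∀ x : X, RowEquiv (d' b) (R x) (hcoord ((f x : MultiProj d') b))) :
    IsRegularMap f := by
  intro x b
  obtain ⟨R, ⟨e, P, hP, hR⟩, h⟩ := hf b
  -- One formula is valid on all of `X`, so no smaller neighbourhood is needed; in the applications
  -- `X` already lies over a chart.
  refine ⟨Set.univ, @isOpen_univ _ (zariskiTopology d), trivial, e, fun c => P c,
    fun c => hP c, fun y _ => ?_⟩
  have := h y
  rw [← hR] at this
  exact eq_mk_of_rowEquiv this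

/-- The point of the product with the components `x` and `y`. -/
def pairPt {ι κ : Type} {d : ι → ℕ} {d' : κ → ℕ} (x : MultiProj d) (y : MultiProj d') :
    MultiProj (Sum.elim d d')
  | Sum.inl a => x a
  | Sum.inr b => y b

lemma pairPt_ext {ι κ : Type} {d : ι → ℕ} {d' : κ → ℕ} {x y : MultiProj (Sum.elim d d')}
    (h₁ : fstPt x = fstPt y) (h₂ : sndPt x = sndPt y) : x = y := by
  funext c
  cases c with
  | inl a => exact congrFun h₁ a
  | inr b => exact congrFun h₂ b

/-! ### Chains of rows -/

/-- The rows `v 0, …, v n` are nonzero, and each is, up to its last entry, a multiple of the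
previous one. -/
def IsChain (n : ℕ) (v : ℕ → ℕ → ℂ) : Prop :=
  (∀ k ≤ n, ∃ s ≤ k, v k s ≠ 0) ∧ ∀ k < n, ∃ c : ℂ, ∀ s ≤ k, v (k + 1) s = c * v k s

lemma IsChain.congr {n : ℕ} {v w : ℕ → ℕ → ℂ} (hv : IsChain n v)
    (h : ∀ k ≤ n, RowEquiv k (w k) (v k)) : IsChain n w := by
  refine ⟨fun k hk => (h k hk).exists_ne_zero (hv.1 k hk), fun k hk => ?_⟩
  obtain ⟨c, hc⟩ := hv.2 k hk
  obtain ⟨c₁, -, h₁⟩ := h (k + 1) hk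
  obtain ⟨c₂, -, h₂⟩ := (h k hk.le).symm
  exact ⟨c₁ * (c * c₂), fun s hs => by rw [h₁ s (by omega), hc s hs, h₂ s hs]; ring⟩

/-- Composing the links of the chain gives `l_k ⊂ l_m ⊕ ⟨e_{m+1}, …, e_k⟩`. -/
lemma IsChain.exists_eq_mul {n m k : ℕ} {v : ℕ → ℕ → ℂ} (hv : IsChain n v) (hmk : m ≤ k)
    (hk : k ≤ n) : ∃ c : ℂ, ∀ s ≤ m, v k s = c * v m s := by
  induction k, hmk using Nat.le_induction with
  | base => exact ⟨1, fun s _ => (one_mul _).symm⟩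
  | succ k hmk ih =>
    obtain ⟨c, hc⟩ := ih (by omega)
    obtain ⟨c', hc'⟩ := hv.2 k (by omega)
    exact ⟨c' * c, fun s hs => by rw [hc' s (by omega), hc s hs, mul_assoc]⟩

/-- The coordinates of a tuple of lines, extended by zero. -/
noncomputable def flagCoord {n : ℕ} (z : MultiProj (bfDim n)) (k : ℕ) : ℕ → ℂ :=
  if h : k < n + 1 then hcoord (z ⟨k, h⟩) else 0

lemma flagCoord_of_lt {n : ℕ} (z : MultiProj (bfDim n)) {k : ℕ} (h : k < n + 1) :
    flagCoord z k = hcoord (z ⟨k, h⟩) := dif_pos h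

lemma flagCoord_fin {n : ℕ} (z : MultiProj (bfDim n)) (k : Fin (n + 1)) :
    flagCoord z k = hcoord (z k) := dif_pos k.2

lemma flag_ext {n : ℕ} {z z' : MultiProj (bfDim n)}
    (h : ∀ k ≤ n, RowEquiv k (flagCoord z k) (flagCoord z' k)) : z = z' := by
  funext k
  have := h k (Nat.lt_succ_iff.mp k.2)
  rw [flagCoord_fin, flagCoord_fin] at this
  exact eq_of_rowEquiv this

lemma mem_BF_iff {n : ℕ} (z : MultiProj (bfDim n)) : z ∈ BF n ↔ IsChain n (flagCoord z) := by
  constructor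
  · intro hz
    have hne : ∀ k ≤ n, ∃ s ≤ k, flagCoord z k s ≠ 0 := fun k hk => by
      rw [flagCoord_of_lt z (Nat.lt_succ_iff.mpr hk)]
      exact exists_hcoord_ne_zero (z ⟨k, Nat.lt_succ_iff.mpr hk⟩)
    refine ⟨hne, fun k hk => ?_⟩
    obtain ⟨t, ht, h0⟩ := hne k hk.le
    -- The row `k` has a nonzero entry at `t`; the minors in the columns `s`, `t` say that the ratio
    -- found there is the ratio everywhere.
    refine ⟨flagCoord z (k + 1) t / flagCoord z k t, fun s hs => ?_⟩
    rw [div_mul_eq_mul_div, eq_div_iff h0]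
    have := hz ⟨k, hk⟩ ⟨s, Nat.lt_succ_iff.mpr hs⟩ ⟨t, Nat.lt_succ_iff.mpr ht⟩
    rw [← hcoord_fin, ← hcoord_fin, ← hcoord_fin, ← hcoord_fin] at this
    rw [flagCoord_of_lt z (show k < n + 1 by omega),
      flagCoord_of_lt z (show k + 1 < n + 1 by omega)]
    exact this
  · intro hz k a b
    obtain ⟨c, hc⟩ := hz.2 k k.2
    have ha := hc a (Nat.lt_succ_iff.mp a.2)
    have hb := hc b (Nat.lt_succ_iff.mp b.2)
    rw [flagCoord_of_lt z (show (k : ℕ) < n + 1 by omega),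
      flagCoord_of_lt z (show (k : ℕ) + 1 < n + 1 by omega)] at ha hb
    rw [← hcoord_fin, ← hcoord_fin, ← hcoord_fin, ← hcoord_fin]
    change hcoord (z ⟨k + 1, _⟩) a * hcoord (z ⟨k, _⟩) b =
      hcoord (z ⟨k + 1, _⟩) b * hcoord (z ⟨k, _⟩) a
    rw [ha, hb]
    ring

/-- The tuple of lines spanned by the rows `v 0, …, v n`. -/
noncomputable def flagOf (n : ℕ) (v : ℕ → ℕ → ℂ) : MultiProj (bfDim n) :=
  fun k => ptOf k (v k)

lemma IsChain.rowEquiv {n k : ℕ} {v : ℕ → ℕ → ℂ} (hv : IsChain n v) (hk : k ≤ n) :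
    RowEquiv k (v k) (flagCoord (flagOf n v) k) := by
  rw [flagCoord_of_lt _ (Nat.lt_succ_iff.mpr hk)]
  exact rowEquiv_hcoord_ptOf (hv.1 k hk)

lemma IsChain.flagCoord_flagOf {n : ℕ} {v : ℕ → ℕ → ℂ} (hv : IsChain n v) :
    IsChain n (flagCoord (flagOf n v)) :=
  hv.congr fun _ hk => (hv.rowEquiv hk).symm

/-! ### The bilinear equation -/

/-- The pairing `∑ₖ v_{i-k} w_{j-k}` of two rows. -/
def pairing (i j : ℕ) (v w : ℕ → ℂ) : ℂ :=
  ∑ k ∈ Finset.range (min i j + 1), v (i - k) * w (j - k)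

lemma pairing_eq_zero_congr {i j : ℕ} {v v' w w' : ℕ → ℂ} (hv : RowEquiv i v v')
    (hw : RowEquiv j w w') : pairing i j v w = 0 ↔ pairing i j v' w' = 0 := by
  obtain ⟨c, hc, hv⟩ := hv
  obtain ⟨c', hc', hw⟩ := hw
  have : pairing i j v w = c * c' * pairing i j v' w' := by
    rw [pairing, pairing, Finset.mul_sum]
    refine Finset.sum_congr rfl fun k _ => ?_
    rw [hv _ (Nat.sub_le _ _), hw _ (Nat.sub_le _ _)]
    ring
  rw [this, mul_eq_zero, or_iff_right (mul_ne_zero hc hc')]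

lemma mem_BR_iff {i j : ℕ} (x : MultiProj (Sum.elim (bfDim i) (fun _ : Unit => j))) :
    x ∈ BR i j ↔ IsChain i (flagCoord (fstPt x)) ∧
      pairing i j (flagCoord (fstPt x) i) (hcoord (sndPt x ())) = 0 := by
  rw [← mem_BF_iff, pairing, ← Fin.sum_univ_eq_sum_range
    (fun k => flagCoord (fstPt x) i (i - k) * hcoord (sndPt x ()) (j - k))]
  refine and_congr (and_iff_left trivial) ?_
  rw [flagCoord_of_lt (fstPt x) (Nat.lt_succ_self i)]
  refine Eq.congr (Finset.sum_congr rfl fun k _ => ?_) rfl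
  rw [hcoord_of_lt _ (Nat.lt_succ_of_le (Nat.sub_le _ _)),
    hcoord_of_lt _ (Nat.lt_succ_of_le (Nat.sub_le _ _))]
  rfl

/-! ### Splitting a chain at a row -/

/-- The coordinates of a vector of `ℂ b ⊕ ⟨e_{m+1}, …⟩` in the basis `b, e_{m+1}, …`, where the
entry of index `a ≤ m` of `b` is one. -/
def fibRow (m a : ℕ) (v : ℕ → ℂ) : ℕ → ℂ :=
  fun s => if s = 0 then v a else v (m + s)

/-- The vector with the coordinates `y` in the basis `b, b_a e_{m+1}, …`. -/
def glueRow (m a : ℕ) (b y : ℕ → ℂ) : ℕ → ℂ :=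
  fun t => if t ≤ m then y 0 * b t else b a * y (t - m)

lemma RowEquiv.fibRow {m a r : ℕ} {v v' : ℕ → ℂ} (ha : a ≤ m) (h : RowEquiv (m + r) v v') :
    RowEquiv r (fibRow m a v) (fibRow m a v') := by
  obtain ⟨c, hc, h⟩ := h
  refine ⟨c, hc, fun s hs => ?_⟩
  unfold BuchstaberRay.fibRow
  split_ifs
  · exact h a (by omega)
  · exact h (m + s) (by omega)

lemma RowEquiv.glueRow {m a r : ℕ} {b b' y y' : ℕ → ℂ} (ha : a ≤ m) (hb : RowEquiv m b b')
    (hy : RowEquiv r y y') : RowEquiv (m + r) (glueRow m a b y) (glueRow m a b' y') := by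
  obtain ⟨c, hc, hb⟩ := hb
  obtain ⟨c', hc', hy⟩ := hy
  refine ⟨c * c', mul_ne_zero hc hc', fun s hs => ?_⟩
  unfold BuchstaberRay.glueRow
  split_ifs with h
  · rw [hb s h, hy 0 (Nat.zero_le _)]; ring
  · rw [hb a ha, hy (s - m) (by omega)]; ring

lemma fibRow_glueRow {m a : ℕ} {b : ℕ → ℂ} (ha : a ≤ m) (hb : b a ≠ 0) (r : ℕ) (y : ℕ → ℂ) :
    RowEquiv r (fibRow m a (glueRow m a b y)) y := by
  refine ⟨b a, hb, fun s _ => ?_⟩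
  rcases Nat.eq_zero_or_pos s with rfl | h
  · rw [fibRow, if_pos rfl, glueRow, if_pos ha, mul_comm]
  · rw [fibRow, if_neg h.ne', glueRow, if_neg (by omega), Nat.add_sub_cancel_left]

/-- If `v` is `c * b` up to the entry `m`, its coordinate along `b / b_a` is `c * b a = v a`, which
is what `fibRow` stores. -/
lemma glueRow_fibRow {m a : ℕ} {b v : ℕ → ℂ} (ha : a ≤ m) (hb : b a ≠ 0)
    (h : ∃ c : ℂ, ∀ s ≤ m, v s = c * b s) (r : ℕ) :
    RowEquiv r (glueRow m a b (fibRow m a v)) v := by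
  obtain ⟨c, hc⟩ := h
  refine ⟨b a, hb, fun s _ => ?_⟩
  unfold glueRow
  split_ifs with h
  · rw [fibRow, if_pos rfl, hc a ha, hc s h]
    ring
  · rw [fibRow, if_neg (by omega), show m + (s - m) = s by omega]

/-- The rows of the fibre coordinates of a chain, relative to its row `m`. -/
def fibRows (m a : ℕ) (v : ℕ → ℕ → ℂ) : ℕ → ℕ → ℂ :=
  fun r => fibRow m a (v (m + r))

/-- The chain that is `b` before the row `m` and has the fibre coordinates `y`. -/
def glueRows (m a : ℕ) (b y : ℕ → ℕ → ℂ) : ℕ → ℕ → ℂ :=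
  fun k => if k < m then b k else glueRow m a (b m) (y (k - m))

lemma glueRows_add (m a r : ℕ) (b y : ℕ → ℕ → ℂ) :
    glueRows m a b y (m + r) = glueRow m a (b m) (y r) := by
  rw [glueRows, if_neg (by omega), Nat.add_sub_cancel_left]

/-- Only `k = m` needs an argument: the glued row is there `y 0 0` times `b m`. -/
lemma glueRows_of_le {m a k : ℕ} {b y : ℕ → ℕ → ℂ} (hk : k ≤ m) (hy : y 0 0 ≠ 0) :
    RowEquiv k (glueRows m a b y k) (b k) := by
  rcases hk.lt_or_eq with h | rfl
  · rw [glueRows, if_pos h]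
    exact RowEquiv.refl _ _
  · have := glueRows_add k a 0 b y
    rw [Nat.add_zero] at this
    rw [this]
    exact ⟨y 0 0, hy, fun s hs => by rw [glueRow, if_pos hs]⟩

lemma isPolyRow_fibRow {ι : Type} {d : ι → ℕ} (m a : ℕ) (c : ι) :
    IsPolyRow (fun x : MultiProj d => fibRow m a (hcoord (x c))) := by
  refine ⟨Finsupp.single c 1, fun s => if s = 0 then coordVar c a else coordVar c (m + s),
    fun s => ?_, fun x => funext fun s => ?_⟩
  · dsimp only
    split_ifs <;> exact isMultihomogeneous_coordVar _ _
  · dsimp only [fibRow]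
    split_ifs <;> exact evalAt_coordVar _ _ _

lemma isPolyRow_glueRow {ι : Type} {d : ι → ℕ} (m a : ℕ) (c c' : ι) :
    IsPolyRow (fun x : MultiProj d => glueRow m a (hcoord (x c)) (hcoord (x c'))) := by
  refine ⟨Finsupp.single c 1 + Finsupp.single c' 1,
    fun s => if s ≤ m then coordVar c s * coordVar c' 0 else coordVar c a * coordVar c' (s - m),
    fun s => ?_, fun x => funext fun s => ?_⟩
  · dsimp only
    split_ifs <;> exact isMultihomogeneous_coordVar_mul _ _ _ _
  · dsimp only [glueRow]
    split_ifs <;> simp only [evalAt_mul, evalAt_coordVar]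
    exact mul_comm _ _

lemma IsChain.zero_zero {n : ℕ} {v : ℕ → ℕ → ℂ} (hv : IsChain n v) : v 0 0 ≠ 0 := by
  obtain ⟨s, hs, h⟩ := hv.1 0 (Nat.zero_le _)
  rwa [Nat.le_zero.mp hs] at h

lemma IsChain.fibRows {m q a : ℕ} {v : ℕ → ℕ → ℂ} (hv : IsChain (m + q) v) (ha : a ≤ m)
    (hne : v m a ≠ 0) : IsChain q (fibRows m a v) := by
  refine ⟨fun r hr => ?_, fun r hr => ?_⟩
  · obtain ⟨t, ht, h0⟩ := hv.1 (m + r) (by omega)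
    by_cases htm : t ≤ m
    · obtain ⟨c, hc⟩ := hv.exists_eq_mul (Nat.le_add_right m r) (by omega)
      refine ⟨0, Nat.zero_le _, ?_⟩
      change v (m + r) a ≠ 0
      rw [hc t htm] at h0
      rw [hc a ha]
      exact mul_ne_zero (left_ne_zero_of_mul h0) hne
    · refine ⟨t - m, by omega, ?_⟩
      rw [BuchstaberRay.fibRows, fibRow, if_neg (by omega), show m + (t - m) = t by omega]
      exact h0
  · obtain ⟨c, hc⟩ := hv.2 (m + r) (by omega)
    refine ⟨c, fun s hs => ?_⟩
    unfold BuchstaberRay.fibRows fibRow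
    split_ifs
    · exact hc a (by omega)
    · exact hc (m + s) (by omega)

lemma IsChain.glueRows {m q a : ℕ} {b y : ℕ → ℕ → ℂ} (hb : IsChain m b) (hy : IsChain q y)
    (ha : a ≤ m) (hne : b m a ≠ 0) : IsChain (m + q) (glueRows m a b y) := by
  have hlow : IsChain m (BuchstaberRay.glueRows m a b y) :=
    hb.congr fun k hk => glueRows_of_le hk hy.zero_zero
  refine ⟨fun k hk => ?_, fun k hk => ?_⟩
  · rcases le_total k m with h | h
    · exact hlow.1 k h
    · obtain ⟨r, rfl⟩ := Nat.exists_eq_add_of_le h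
      rw [glueRows_add]
      obtain ⟨s, hs, h0⟩ := hy.1 r (by omega)
      by_cases hs0 : s = 0
      · refine ⟨a, by omega, ?_⟩
        rw [glueRow, if_pos ha]
        subst hs0
        exact mul_ne_zero h0 hne
      · refine ⟨m + s, by omega, ?_⟩
        rw [glueRow, if_neg (by omega), Nat.add_sub_cancel_left]
        exact mul_ne_zero hne h0
  · rcases lt_or_ge k m with h | h
    · exact hlow.2 k h
    · obtain ⟨r, rfl⟩ := Nat.exists_eq_add_of_le h
      obtain ⟨c, hc⟩ := hy.2 r (by omega)
      refine ⟨c, fun s hs => ?_⟩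
      rw [add_assoc, glueRows_add, glueRows_add]
      unfold glueRow
      split_ifs
      · rw [hc 0 (Nat.zero_le _)]; ring
      · rw [hc (s - m) (by omega)]; ring

/-- Since `k ≤ j`, the index `j + 1 - k` is at least one: the coordinate along `l_m` never enters
the equation. -/
lemma pairing_fibRow (m a j : ℕ) (v w : ℕ → ℂ) :
    pairing (j + 1) j (fibRow m a v) w = pairing (m + (j + 1)) j v w := by
  unfold pairing
  rw [show min (m + (j + 1)) j = j by omega, show min (j + 1) j = j by omega]
  refine Finset.sum_congr rfl fun k hk => ?_
  have := Finset.mem_range.mp hk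
  rw [fibRow, if_neg (by omega), show m + (j + 1 - k) = m + (j + 1) - k by omega]

lemma pairing_glueRow (m a j : ℕ) (b y w : ℕ → ℂ) :
    pairing (m + (j + 1)) j (glueRow m a b y) w = b a * pairing (j + 1) j y w := by
  unfold pairing
  rw [show min (m + (j + 1)) j = j by omega, show min (j + 1) j = j by omega, Finset.mul_sum]
  refine Finset.sum_congr rfl fun k hk => ?_
  have := Finset.mem_range.mp hk
  rw [glueRow, if_neg (by omega), show m + (j + 1) - k - m = j + 1 - k by omega, mul_assoc]

/-! ### Change of coordinates on the second factor -/

/-- The coordinates of the linear form `w` that are adapted to the line `b` in the plane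
`⟨e_0, e_1⟩`, where `b a ≠ 0`, `a ≤ 1`: the entry of index `1` is the value of `w` on `b`. -/
def adaptRow (a : ℕ) (b w : ℕ → ℂ) : ℕ → ℂ :=
  fun s => if s = 0 then b a * w (1 - a) else if s = 1 then b 0 * w 0 + b 1 * w 1 else b a * w s

/-- The inverse, up to a factor, of `adaptRow`. -/
def unadaptRow (a : ℕ) (b u : ℕ → ℂ) : ℕ → ℂ :=
  fun s => if s = 1 - a then b a * u 0 else if s = a then b a * u 1 - b (1 - a) * u 0
    else b a * u s

/-- The value on `b` and the entry `1 - a` determine the entry `a`, because `w(b) - b_{1-a} w_{1-a}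
= b_a w_a`. Clearing the denominator costs one factor `b a` in each direction. -/
lemma adaptRow_unadaptRow {a : ℕ} (ha : a ≤ 1) (b u : ℕ → ℂ) (s : ℕ) :
    adaptRow a b (unadaptRow a b u) s = b a * b a * u s := by
  rcases s with _ | _ | s <;> interval_cases a <;> simp [adaptRow, unadaptRow] <;> ring

lemma unadaptRow_adaptRow {a : ℕ} (ha : a ≤ 1) (b w : ℕ → ℂ) (s : ℕ) :
    unadaptRow a b (adaptRow a b w) s = b a * b a * w s := by
  rcases s with _ | _ | s <;> interval_cases a <;> simp [adaptRow, unadaptRow] <;> ring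

lemma RowEquiv.adaptRow {a n : ℕ} {b b' w w' : ℕ → ℂ} (ha : a ≤ 1) (hn : 1 ≤ n)
    (hb : RowEquiv 1 b b') (hw : RowEquiv n w w') :
    RowEquiv n (adaptRow a b w) (adaptRow a b' w') := by
  obtain ⟨c, hc, hb⟩ := hb
  obtain ⟨c', hc', hw⟩ := hw
  refine ⟨c * c', mul_ne_zero hc hc', fun s hs => ?_⟩
  unfold BuchstaberRay.adaptRow
  rw [hb a ha, hb 0 zero_le_one, hb 1 le_rfl, hw (1 - a) (by omega), hw 0 (by omega), hw 1 hn,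
    hw s hs]
  split_ifs <;> ring

lemma RowEquiv.unadaptRow {a n : ℕ} {b b' w w' : ℕ → ℂ} (ha : a ≤ 1) (hn : 1 ≤ n)
    (hb : RowEquiv 1 b b') (hw : RowEquiv n w w') :
    RowEquiv n (unadaptRow a b w) (unadaptRow a b' w') := by
  obtain ⟨c, hc, hb⟩ := hb
  obtain ⟨c', hc', hw⟩ := hw
  refine ⟨c * c', mul_ne_zero hc hc', fun s hs => ?_⟩
  unfold BuchstaberRay.unadaptRow
  rw [hb a ha, hb (1 - a) (by omega), hw 0 (by omega), hw 1 hn, hw s hs]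
  split_ifs <;> ring

lemma unadaptRow_adaptRow_rowEquiv {a : ℕ} (ha : a ≤ 1) {b : ℕ → ℂ} (hb : b a ≠ 0) (n : ℕ)
    (w : ℕ → ℂ) : RowEquiv n (unadaptRow a b (adaptRow a b w)) w :=
  ⟨b a * b a, mul_ne_zero hb hb, fun s _ => unadaptRow_adaptRow ha b w s⟩

lemma adaptRow_unadaptRow_rowEquiv {a : ℕ} (ha : a ≤ 1) {b : ℕ → ℂ} (hb : b a ≠ 0) (n : ℕ)
    (u : ℕ → ℂ) : RowEquiv n (adaptRow a b (unadaptRow a b u)) u :=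
  ⟨b a * b a, mul_ne_zero hb hb, fun s _ => adaptRow_unadaptRow ha b u s⟩

/-- If the image vanished, applying the inverse would make `w` vanish. -/
lemma adaptRow_ne_zero {a n : ℕ} (ha : a ≤ 1) (hn : 1 ≤ n) {b w : ℕ → ℂ} (hb : b a ≠ 0)
    (hw : ∃ s ≤ n, w s ≠ 0) : ∃ s ≤ n, adaptRow a b w s ≠ 0 := by
  by_contra! h
  obtain ⟨s, hs, h0⟩ := (unadaptRow_adaptRow_rowEquiv ha hb n w).exists_ne_zero hw
  refine h0 ?_
  unfold unadaptRow
  rw [h 0 (Nat.zero_le _), h 1 hn, h s hs]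
  split_ifs <;> ring

lemma unadaptRow_ne_zero {a n : ℕ} (ha : a ≤ 1) (hn : 1 ≤ n) {b u : ℕ → ℂ} (hb : b a ≠ 0)
    (hu : ∃ s ≤ n, u s ≠ 0) : ∃ s ≤ n, unadaptRow a b u s ≠ 0 := by
  by_contra! h
  obtain ⟨s, hs, h0⟩ := (adaptRow_unadaptRow_rowEquiv ha hb n u).exists_ne_zero hu
  refine h0 ?_
  unfold adaptRow
  rw [h 0 (Nat.zero_le _), h 1 hn, h (1 - a) (by omega), h s hs]
  split_ifs <;> ring

lemma isPolyRow_adaptRow {ι : Type} {d : ι → ℕ} (a : ℕ) (c c' : ι) :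
    IsPolyRow (fun x : MultiProj d => adaptRow a (hcoord (x c)) (hcoord (x c'))) := by
  refine ⟨Finsupp.single c 1 + Finsupp.single c' 1,
    fun s => if s = 0 then coordVar c a * coordVar c' (1 - a)
      else if s = 1 then coordVar c 0 * coordVar c' 0 + coordVar c 1 * coordVar c' 1
      else coordVar c a * coordVar c' s,
    fun s => ?_, fun x => funext fun s => ?_⟩
  · dsimp only
    split_ifs
    · exact isMultihomogeneous_coordVar_mul _ _ _ _
    · exact MvPolynomial.IsWeightedHomogeneous.add (isMultihomogeneous_coordVar_mul _ _ _ _)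
        (isMultihomogeneous_coordVar_mul _ _ _ _)
    · exact isMultihomogeneous_coordVar_mul _ _ _ _
  · dsimp only [adaptRow]
    split_ifs <;> simp only [evalAt_add, evalAt_mul, evalAt_coordVar]

lemma isPolyRow_unadaptRow {ι : Type} {d : ι → ℕ} (a : ℕ) (c c' : ι) :
    IsPolyRow (fun x : MultiProj d => unadaptRow a (hcoord (x c)) (hcoord (x c'))) := by
  refine ⟨Finsupp.single c 1 + Finsupp.single c' 1,
    fun s => if s = 1 - a then coordVar c a * coordVar c' 0
      else if s = a then coordVar c a * coordVar c' 1 - coordVar c (1 - a) * coordVar c' 0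
      else coordVar c a * coordVar c' s,
    fun s => ?_, fun x => funext fun s => ?_⟩
  · dsimp only
    split_ifs
    · exact isMultihomogeneous_coordVar_mul _ _ _ _
    · exact (isMultihomogeneous_coordVar_mul _ _ _ _).sub (isMultihomogeneous_coordVar_mul _ _ _ _)
    · exact isMultihomogeneous_coordVar_mul _ _ _ _
  · dsimp only [unadaptRow]
    split_ifs <;> simp only [evalAt_sub, evalAt_mul, evalAt_coordVar]

/-- This is the evaluation of `w` on the glued row: its part along `b` contributes `y 0 * w(b)`, and
`w(b)` is the entry of index one of `adaptRow`. -/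
lemma pairing_adaptRow {i q : ℕ} (hi : i = 1 + q) (a : ℕ) (b y w : ℕ → ℂ) :
    pairing q i y (adaptRow a b w) = pairing i i (glueRow 1 a b y) w := by
  rw [add_comm] at hi
  subst hi
  have h₁ : pairing q (q + 1) y (adaptRow a b w) =
      ∑ s ∈ Finset.range (q + 1), y s * adaptRow a b w (s + 1) := by
    unfold pairing
    rw [min_eq_left (Nat.le_succ q),
      ← Finset.sum_range_reflect (fun s => y s * adaptRow a b w (s + 1))]
    refine Finset.sum_congr rfl fun k hk => ?_
    have := Finset.mem_range.mp hk
    rw [show q + 1 - 1 - k = q - k by omega, show q + 1 - k = q - k + 1 by omega]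
  have h₂ : pairing (q + 1) (q + 1) (glueRow 1 a b y) w =
      ∑ s ∈ Finset.range (q + 1 + 1), glueRow 1 a b y s * w s := by
    unfold pairing
    rw [min_self, ← Finset.sum_range_reflect (fun s => glueRow 1 a b y s * w s)]
    exact Finset.sum_congr rfl fun k _ => rfl
  -- The terms with `w_2, w_3, …` match one by one; what remains is `y_0 u_1` against the two lowest
  -- terms on the right.
  rw [h₁, h₂, Finset.sum_range_succ', Finset.sum_range_succ' _ (q + 1),
    Finset.sum_range_succ' _ q, add_assoc]
  congr 1
  · refine Finset.sum_congr rfl fun s _ => ?_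
    simp only [adaptRow, glueRow]
    rw [if_neg (by omega), if_neg (by omega), if_neg (by omega),
      show s + 1 + 1 - 1 = s + 1 by omega]
    ring
  · simp [adaptRow, glueRow]
    ring

/-! ### The bundle over a bounded flag variety -/

section OverFlags

variable {i j m a : ℕ}

lemma flagCoord_toBF (h : m ≤ i) (x : BR i j) {k : ℕ} (hk : k ≤ m) :
    flagCoord (BR.toBF h x).1 k = flagCoord (fstPt x.1) k := by
  rw [flagCoord_of_lt _ (Nat.lt_succ_iff.mpr hk),
    flagCoord_of_lt _ (Nat.lt_succ_iff.mpr (hk.trans h))]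
  rfl

lemma isRegularMap_toBF (h : m ≤ i) : IsRegularMap (BR.toBF (i := i) (j := j) h) :=
  isRegularMap_of_rowEquiv fun k =>
    ⟨_, isPolyRow_hcoord (Sum.inl (Fin.castLE (Nat.succ_le_succ h) k)), fun _ => RowEquiv.refl _ _⟩

/-- The trivialisation of `BR_{i,j} → BF_m`, where `i = m + j + 1`, over `{z_{m,a} ≠ 0}`, in
homogeneous coordinates. -/
noncomputable def toFlagProduct (h : m ≤ i) (a : ℕ) (x : BR i j) :
    MultiProj (Sum.elim (bfDim m) (Sum.elim (bfDim (j + 1)) (fun _ : Unit => j))) :=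
  pairPt (BR.toBF h x).1
    (pairPt (flagOf (j + 1) (fibRows m a (flagCoord (fstPt x.1)))) (sndPt x.1))

/-- The inverse of `toFlagProduct`. -/
noncomputable def ofFlagProduct (i a : ℕ)
    (y : MultiProj (Sum.elim (bfDim m) (Sum.elim (bfDim (j + 1)) (fun _ : Unit => j)))) :
    MultiProj (Sum.elim (bfDim i) (fun _ : Unit => j)) :=
  pairPt (flagOf i (glueRows m a (flagCoord (fstPt y)) (flagCoord (fstPt (sndPt y)))))
    (sndPt (sndPt y))

lemma isChain_fibRows_flagCoord (hi : i = m + (j + 1)) (ha : a ≤ m) (x : BR i j)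
    (hx : flagCoord (fstPt x.1) m a ≠ 0) :
    IsChain (j + 1) (fibRows m a (flagCoord (fstPt x.1))) := by
  subst hi
  exact ((mem_BR_iff _).mp x.2).1.fibRows ha hx

lemma toFlagProduct_mem (h : m ≤ i) (hi : i = m + (j + 1)) (ha : a ≤ m) (x : BR i j)
    (hx : flagCoord (fstPt x.1) m a ≠ 0) :
    sndPt (toFlagProduct h a x) ∈ BR (j + 1) j := by
  have hf := isChain_fibRows_flagCoord hi ha x hx
  subst hi
  refine (mem_BR_iff _).mpr ⟨hf.flagCoord_flagOf, ?_⟩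
  refine (pairing_eq_zero_congr (hf.rowEquiv le_rfl) (RowEquiv.refl _ _)).mp ?_
  rw [fibRows, pairing_fibRow]
  exact ((mem_BR_iff _).mp x.2).2

variable {y : MultiProj (Sum.elim (bfDim m) (Sum.elim (bfDim (j + 1)) (fun _ : Unit => j)))}

lemma isChain_glueRows_flagCoord (hi : i = m + (j + 1)) (ha : a ≤ m) (hy₁ : fstPt y ∈ BF m)
    (hy₂ : sndPt y ∈ BR (j + 1) j) (hy : flagCoord (fstPt y) m a ≠ 0) :
    IsChain i (glueRows m a (flagCoord (fstPt y)) (flagCoord (fstPt (sndPt y)))) := by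
  subst hi
  exact ((mem_BF_iff _).mp hy₁).glueRows ((mem_BR_iff _).mp hy₂).1 ha hy

lemma ofFlagProduct_mem (hi : i = m + (j + 1)) (ha : a ≤ m) (hy₁ : fstPt y ∈ BF m)
    (hy₂ : sndPt y ∈ BR (j + 1) j) (hy : flagCoord (fstPt y) m a ≠ 0) :
    ofFlagProduct i a y ∈ BR i j := by
  have hf := isChain_glueRows_flagCoord hi ha hy₁ hy₂ hy
  subst hi
  refine (mem_BR_iff _).mpr ⟨hf.flagCoord_flagOf, ?_⟩
  refine (pairing_eq_zero_congr (hf.rowEquiv le_rfl) (RowEquiv.refl _ _)).mp ?_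
  rw [glueRows_add, pairing_glueRow]
  exact mul_eq_zero_of_right _ ((mem_BR_iff _).mp hy₂).2

lemma fst_ofFlagProduct (h : m ≤ i) (hi : i = m + (j + 1)) (ha : a ≤ m) (hy₁ : fstPt y ∈ BF m)
    (hy₂ : sndPt y ∈ BR (j + 1) j) (hy : flagCoord (fstPt y) m a ≠ 0) :
    (BR.toBF h ⟨_, ofFlagProduct_mem hi ha hy₁ hy₂ hy⟩).1 = fstPt y := by
  have hf := isChain_glueRows_flagCoord hi ha hy₁ hy₂ hy
  refine flag_ext fun k hk => ?_
  rw [flagCoord_toBF h _ hk]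
  exact (hf.rowEquiv (hk.trans h)).symm.trans
    (glueRows_of_le hk ((mem_BR_iff _).mp hy₂).1.zero_zero)

lemma ofFlagProduct_toFlagProduct (h : m ≤ i) (hi : i = m + (j + 1)) (ha : a ≤ m) (x : BR i j)
    (hx : flagCoord (fstPt x.1) m a ≠ 0) : ofFlagProduct i a (toFlagProduct h a x) = x.1 := by
  have hf := isChain_fibRows_flagCoord hi ha x hx
  have hb : ∀ {k : ℕ}, k ≤ m →
      flagCoord (fstPt (toFlagProduct h a x)) k = flagCoord (fstPt x.1) k :=
    flagCoord_toBF h x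
  have hx' : flagCoord (fstPt (toFlagProduct h a x)) m a ≠ 0 := by rwa [hb le_rfl]
  have hm := toFlagProduct_mem h hi ha x hx
  have hg := isChain_glueRows_flagCoord (y := toFlagProduct h a x) hi ha (BR.toBF h x).2 hm hx'
  refine pairPt_ext (flag_ext fun k hk => (hg.rowEquiv hk).symm.trans ?_) rfl
  rcases lt_or_ge k m with hkm | hkm
  · rw [glueRows, if_pos hkm, hb hkm.le]
    exact RowEquiv.refl _ _
  · obtain ⟨r, rfl⟩ := Nat.exists_eq_add_of_le hkm
    rw [glueRows_add, hb le_rfl]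
    exact (RowEquiv.glueRow ha (RowEquiv.refl _ _) (hf.rowEquiv (by omega)).symm).trans
      (glueRow_fibRow ha hx (((mem_BR_iff _).mp x.2).1.exists_eq_mul hkm hk) _)

lemma toFlagProduct_ofFlagProduct (h : m ≤ i) (hi : i = m + (j + 1)) (ha : a ≤ m)
    (hy₁ : fstPt y ∈ BF m) (hy₂ : sndPt y ∈ BR (j + 1) j) (hy : flagCoord (fstPt y) m a ≠ 0)
    (hy' : flagCoord (fstPt (ofFlagProduct i a y)) m a ≠ 0) :
    toFlagProduct h a ⟨_, ofFlagProduct_mem hi ha hy₁ hy₂ hy⟩ = y := by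
  have hg := isChain_glueRows_flagCoord hi ha hy₁ hy₂ hy
  have hf := isChain_fibRows_flagCoord hi ha ⟨_, ofFlagProduct_mem hi ha hy₁ hy₂ hy⟩ hy'
  refine pairPt_ext (fst_ofFlagProduct h hi ha hy₁ hy₂ hy)
    (pairPt_ext (flag_ext fun r hr => (hf.rowEquiv hr).symm.trans ?_) rfl)
  refine (RowEquiv.fibRow ha (hg.rowEquiv (k := m + r) (by omega)).symm).trans ?_
  rw [glueRows_add]
  exact fibRow_glueRow ha hy _ _

lemma isZariskiFiberBundle_toBF (h : m ≤ i) (hi : i = m + (j + 1)) :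
    IsZariskiFiberBundle (BR.toBF (i := i) (j := j) h) (BR (j + 1) j) := by
  refine ⟨isRegularMap_toBF h, fun b => ?_⟩
  -- The trivialising neighbourhood is the standard chart of the last line `l_m` containing the
  -- given point.
  obtain ⟨a, ha, hba⟩ := exists_hcoord_ne_zero (b.1 (Fin.last m))
  have hU : ∀ z : MultiProj (bfDim m), hcoord (z (Fin.last m)) = flagCoord z m :=
    fun z => (flagCoord_fin z (Fin.last m)).symm
  have hE : ∀ x : BR i j, hcoord ((BR.toBF h x).1 (Fin.last m)) = flagCoord (fstPt x.1) m :=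
    fun x => (hU _).trans (flagCoord_toBF h x le_rfl)
  have hx : ∀ x : preimageVar (BR.toBF (i := i) (j := j) h)
      {z | hcoord (z (Fin.last m)) a ≠ 0}, flagCoord (fstPt x.1) m a ≠ 0 := fun x => by
    have := x.2.2
    rwa [Set.mem_ofPred_eq, hE] at this
  have hy : ∀ y : prodVar (BF m ∩ {z | hcoord (z (Fin.last m)) a ≠ 0}) (BR (j + 1) j),
      flagCoord (fstPt y.1) m a ≠ 0 := fun y => by
    have := y.2.1.2
    rwa [Set.mem_ofPred_eq, hU] at this
  have hinv : ∀ y : prodVar (BF m ∩ {z | hcoord (z (Fin.last m)) a ≠ 0}) (BR (j + 1) j),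
      ofFlagProduct i a y.1 ∈ preimageVar (BR.toBF (i := i) (j := j) h)
        {z | hcoord (z (Fin.last m)) a ≠ 0} := fun y =>
    ⟨ofFlagProduct_mem hi ha y.2.1.1 y.2.2 (hy y), by
      rw [fst_ofFlagProduct h hi ha y.2.1.1 y.2.2 (hy y)]
      exact y.2.1.2⟩
  refine ⟨{z | hcoord (z (Fin.last m)) a ≠ 0}, isOpen_hcoord_ne_zero _ _, hba,
    { toFun := fun x => ⟨toFlagProduct h a ⟨x.1, x.2.1⟩, ⟨(BR.toBF h ⟨x.1, x.2.1⟩).2, x.2.2⟩,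
        toFlagProduct_mem h hi ha ⟨x.1, x.2.1⟩ (hx x)⟩
      invFun := fun y => ⟨ofFlagProduct i a y.1, hinv y⟩
      left_inv := fun x => Subtype.ext (ofFlagProduct_toFlagProduct h hi ha ⟨x.1, x.2.1⟩ (hx x))
      right_inv := fun y => Subtype.ext
        (toFlagProduct_ofFlagProduct h hi ha y.2.1.1 y.2.2 (hy y) (hx ⟨_, hinv y⟩)) },
    isRegularMap_of_rowEquiv ?_, isRegularMap_of_rowEquiv ?_, fun x => rfl⟩
  · rintro (k | r | u)
    · exact ⟨_, isPolyRow_hcoord (Sum.inl (Fin.castLE (Nat.succ_le_succ h) k)),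
        fun _ => RowEquiv.refl _ _⟩
    · have hr : m + r < i + 1 := by omega
      refine ⟨_, isPolyRow_fibRow m a (Sum.inl ⟨m + r, hr⟩), fun x => ?_⟩
      have := (isChain_fibRows_flagCoord hi ha ⟨x.1, x.2.1⟩ (hx x)).rowEquiv
        (Nat.lt_succ_iff.mp r.2)
      rw [flagCoord_fin, fibRows, flagCoord_of_lt _ hr] at this
      exact this
    · exact ⟨_, isPolyRow_hcoord (Sum.inr u), fun _ => RowEquiv.refl _ _⟩
  · rintro (k | u)
    · have hg := fun y : prodVar (BF m ∩ {z | hcoord (z (Fin.last m)) a ≠ 0}) (BR (j + 1) j) =>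
        (isChain_glueRows_flagCoord hi ha y.2.1.1 y.2.2 (hy y)).rowEquiv
          (Nat.lt_succ_iff.mp k.2)
      simp only [flagCoord_fin] at hg
      -- Lines before `l_m` are read off the base; from `l_m` on, the row is bilinear in `l_m` and
      -- the fibre line of index `k - m`.
      rcases lt_or_ge (k : ℕ) m with hk | hk
      · refine ⟨_, isPolyRow_hcoord (Sum.inl ⟨k, by omega⟩), fun y => ?_⟩
        have := hg y
        rw [glueRows, if_pos hk, flagCoord_of_lt _ (by omega)] at this
        exact this
      · refine ⟨_, isPolyRow_glueRow m a (Sum.inl (Fin.last m))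
          (Sum.inr (Sum.inl ⟨k - m, by omega⟩)), fun y => ?_⟩
        have := hg y
        rw [glueRows, if_neg (by omega), ← hU, flagCoord_of_lt _ (by omega)] at this
        exact this
    · exact ⟨_, isPolyRow_hcoord (Sum.inr (Sum.inr u)), fun _ => RowEquiv.refl _ _⟩

end OverFlags

/-! ### The bundle over the projective line -/

section OverLine

variable {i q a : ℕ}

/-- The rows of the chain of length one given by a point of `ℙ^1`. -/
noncomputable def lineRows (b : MultiProj (fun _ : Unit => 1)) : ℕ → ℕ → ℂ :=
  fun k => if k = 0 then fun _ => 1 else hcoord (b ())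

lemma lineRows_one (b : MultiProj (fun _ : Unit => 1)) : lineRows b 1 = hcoord (b ()) := rfl

lemma isChain_lineRows (b : MultiProj (fun _ : Unit => 1)) : IsChain 1 (lineRows b) := by
  constructor
  · intro k hk
    interval_cases k
    · exact ⟨0, le_rfl, one_ne_zero⟩
    · exact exists_hcoord_ne_zero (b ())
  · intro k hk
    obtain rfl : k = 0 := by omega
    refine ⟨lineRows b 1 0, fun s hs => ?_⟩
    obtain rfl : s = 0 := by omega
    exact (mul_one _).symm

lemma hcoord_toLine (h : 1 ≤ i) (x : BR i i) :
    hcoord ((BR.toLine h x).1 ()) = flagCoord (fstPt x.1) 1 :=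
  (flagCoord_of_lt (fstPt x.1) (Nat.lt_succ_of_le h)).symm

lemma isRegularMap_toLine (h : 1 ≤ i) : IsRegularMap (BR.toLine (i := i) (j := i) h) :=
  isRegularMap_of_rowEquiv fun _ =>
    ⟨_, isPolyRow_hcoord (Sum.inl ⟨1, Nat.lt_succ_of_le h⟩), fun _ => RowEquiv.refl _ _⟩

/-- The trivialisation of `BR_{i,i} → ℙ^1`, where `i = q + 1`, over `{z_{1,a} ≠ 0}`, in
homogeneous coordinates. -/
noncomputable def toLineProduct (h : 1 ≤ i) (q a : ℕ) (x : BR i i) :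
    MultiProj (Sum.elim (fun _ : Unit => 1) (Sum.elim (bfDim q) (fun _ : Unit => i))) :=
  pairPt (BR.toLine h x).1
    (pairPt (flagOf q (fibRows 1 a (flagCoord (fstPt x.1))))
      (fun _ => ptOf i (adaptRow a (flagCoord (fstPt x.1) 1) (hcoord (sndPt x.1 ())))))

/-- The inverse of `toLineProduct`. -/
noncomputable def ofLineProduct (a : ℕ)
    (y : MultiProj (Sum.elim (fun _ : Unit => 1) (Sum.elim (bfDim q) (fun _ : Unit => i)))) :
    MultiProj (Sum.elim (bfDim i) (fun _ : Unit => i)) :=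
  pairPt (flagOf i (glueRows 1 a (lineRows (fstPt y)) (flagCoord (fstPt (sndPt y)))))
    (fun _ => ptOf i (unadaptRow a (hcoord (fstPt y ())) (hcoord (sndPt (sndPt y) ()))))

lemma isChain_fibRows_one (hi : i = 1 + q) (ha : a ≤ 1) (x : BR i i)
    (hx : flagCoord (fstPt x.1) 1 a ≠ 0) : IsChain q (fibRows 1 a (flagCoord (fstPt x.1))) := by
  subst hi
  exact ((mem_BR_iff _).mp x.2).1.fibRows ha hx

lemma rowEquiv_adaptRow_toLineProduct (h : 1 ≤ i) (ha : a ≤ 1) (x : BR i i)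
    (hx : flagCoord (fstPt x.1) 1 a ≠ 0) :
    RowEquiv i (adaptRow a (flagCoord (fstPt x.1) 1) (hcoord (sndPt x.1 ())))
      (hcoord (sndPt (sndPt (toLineProduct h q a x)) ())) :=
  rowEquiv_hcoord_ptOf (adaptRow_ne_zero ha h hx (exists_hcoord_ne_zero (sndPt x.1 ())))

lemma toLineProduct_mem (h : 1 ≤ i) (hi : i = 1 + q) (ha : a ≤ 1) (x : BR i i)
    (hx : flagCoord (fstPt x.1) 1 a ≠ 0) : sndPt (toLineProduct h q a x) ∈ BR q i := by
  have hf := isChain_fibRows_one hi ha x hx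
  refine (mem_BR_iff _).mpr ⟨hf.flagCoord_flagOf, ?_⟩
  refine (pairing_eq_zero_congr (hf.rowEquiv le_rfl)
    (rowEquiv_adaptRow_toLineProduct h ha x hx)).mp ?_
  -- In the new coordinates the equation is that of the reglued row, which spans the original `l_i`.
  rw [pairing_adaptRow hi, fibRows, ← hi]
  obtain ⟨hc, h0⟩ := (mem_BR_iff _).mp x.2
  exact (pairing_eq_zero_congr (glueRow_fibRow ha hx (hc.exists_eq_mul h le_rfl) i)
    (RowEquiv.refl _ _)).mpr h0

variable {y : MultiProj (Sum.elim (fun _ : Unit => 1) (Sum.elim (bfDim q) (fun _ : Unit => i)))}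

lemma isChain_glueRows_lineRows (hi : i = 1 + q) (ha : a ≤ 1) (hy₂ : sndPt y ∈ BR q i)
    (hy : hcoord (fstPt y ()) a ≠ 0) :
    IsChain i (glueRows 1 a (lineRows (fstPt y)) (flagCoord (fstPt (sndPt y)))) := by
  subst hi
  exact (isChain_lineRows _).glueRows ((mem_BR_iff _).mp hy₂).1 ha hy

lemma rowEquiv_unadaptRow_ofLineProduct (h : 1 ≤ i) (ha : a ≤ 1)
    (hy : hcoord (fstPt y ()) a ≠ 0) :
    RowEquiv i (unadaptRow a (hcoord (fstPt y ())) (hcoord (sndPt (sndPt y) ())))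
      (hcoord (sndPt (ofLineProduct a y) ())) :=
  rowEquiv_hcoord_ptOf (unadaptRow_ne_zero ha h hy (exists_hcoord_ne_zero (sndPt (sndPt y) ())))

lemma ofLineProduct_mem (h : 1 ≤ i) (hi : i = 1 + q) (ha : a ≤ 1) (hy₂ : sndPt y ∈ BR q i)
    (hy : hcoord (fstPt y ()) a ≠ 0) : ofLineProduct a y ∈ BR i i := by
  have hf := isChain_glueRows_lineRows hi ha hy₂ hy
  refine (mem_BR_iff _).mpr ⟨hf.flagCoord_flagOf, ?_⟩
  refine (pairing_eq_zero_congr (hf.rowEquiv le_rfl)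
    (rowEquiv_unadaptRow_ofLineProduct h ha hy)).mp ?_
  have hg := glueRows_add 1 a q (lineRows (fstPt y)) (flagCoord (fstPt (sndPt y)))
  rw [← hi] at hg
  rw [hg, ← pairing_adaptRow hi]
  exact (pairing_eq_zero_congr (RowEquiv.refl _ _)
    (adaptRow_unadaptRow_rowEquiv ha hy i _)).mpr ((mem_BR_iff _).mp hy₂).2

lemma rowEquiv_flagCoord_ofLineProduct (h : 1 ≤ i) (hi : i = 1 + q) (ha : a ≤ 1)
    (hy₂ : sndPt y ∈ BR q i) (hy : hcoord (fstPt y ()) a ≠ 0) :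
    RowEquiv 1 (flagCoord (fstPt (ofLineProduct a y)) 1) (hcoord (fstPt y ())) :=
  ((isChain_glueRows_lineRows hi ha hy₂ hy).rowEquiv h).symm.trans
    (glueRows_of_le le_rfl ((mem_BR_iff _).mp hy₂).1.zero_zero)

lemma fst_ofLineProduct (h : 1 ≤ i) (hi : i = 1 + q) (ha : a ≤ 1) (hy₂ : sndPt y ∈ BR q i)
    (hy : hcoord (fstPt y ()) a ≠ 0) :
    (BR.toLine h ⟨_, ofLineProduct_mem h hi ha hy₂ hy⟩).1 = fstPt y := by
  funext u
  refine eq_of_rowEquiv (n := 1) ?_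
  exact hcoord_toLine h ⟨_, ofLineProduct_mem h hi ha hy₂ hy⟩ ▸
    rowEquiv_flagCoord_ofLineProduct h hi ha hy₂ hy

lemma ofLineProduct_toLineProduct (h : 1 ≤ i) (hi : i = 1 + q) (ha : a ≤ 1) (x : BR i i)
    (hx : flagCoord (fstPt x.1) 1 a ≠ 0) : ofLineProduct a (toLineProduct h q a x) = x.1 := by
  have hf := isChain_fibRows_one hi ha x hx
  have hb : hcoord (fstPt (toLineProduct h q a x) ()) = flagCoord (fstPt x.1) 1 :=
    hcoord_toLine h x
  have hx' : hcoord (fstPt (toLineProduct h q a x) ()) a ≠ 0 := by rwa [hb]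
  have hm := toLineProduct_mem h hi ha x hx
  have hg := isChain_glueRows_lineRows hi ha hm hx'
  have hc := ((mem_BR_iff _).mp x.2).1
  refine pairPt_ext (flag_ext fun k hk => (hg.rowEquiv hk).symm.trans ?_)
    (funext fun u => eq_of_rowEquiv
      ((rowEquiv_unadaptRow_ofLineProduct h ha hx').symm.trans ?_))
  · rcases lt_or_ge k 1 with hk1 | hk1
    · obtain rfl : k = 0 := by omega
      rw [glueRows, if_pos hk1]
      refine RowEquiv.symm ⟨_, hc.zero_zero, fun s hs => ?_⟩
      obtain rfl : s = 0 := by omega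
      exact (mul_one _).symm
    · obtain ⟨r, rfl⟩ := Nat.exists_eq_add_of_le hk1
      rw [glueRows_add, lineRows_one, hb]
      exact (RowEquiv.glueRow ha (RowEquiv.refl _ _) (hf.rowEquiv (by omega)).symm).trans
        (glueRow_fibRow ha hx (hc.exists_eq_mul hk1 hk) _)
  · rw [hb]
    exact (RowEquiv.unadaptRow ha h (RowEquiv.refl _ _)
      (rowEquiv_adaptRow_toLineProduct h ha x hx).symm).trans
      (unadaptRow_adaptRow_rowEquiv ha hx _ _)

lemma toLineProduct_ofLineProduct (h : 1 ≤ i) (hi : i = 1 + q) (ha : a ≤ 1)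
    (hy₂ : sndPt y ∈ BR q i) (hy : hcoord (fstPt y ()) a ≠ 0)
    (hy' : flagCoord (fstPt (ofLineProduct a y)) 1 a ≠ 0) :
    toLineProduct h q a ⟨_, ofLineProduct_mem h hi ha hy₂ hy⟩ = y := by
  have hg := isChain_glueRows_lineRows hi ha hy₂ hy
  have hf := isChain_fibRows_one hi ha ⟨_, ofLineProduct_mem h hi ha hy₂ hy⟩ hy'
  refine pairPt_ext (fst_ofLineProduct h hi ha hy₂ hy)
    (pairPt_ext (flag_ext fun r hr => (hf.rowEquiv hr).symm.trans ?_)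
      (funext fun u => eq_of_rowEquiv ((rowEquiv_adaptRow_toLineProduct h ha
        ⟨_, ofLineProduct_mem h hi ha hy₂ hy⟩ hy').symm.trans ?_)))
  · refine (RowEquiv.fibRow ha (hg.rowEquiv (k := 1 + r) (by omega)).symm).trans ?_
    rw [glueRows_add]
    exact fibRow_glueRow ha hy _ _
  · exact (RowEquiv.adaptRow ha h (rowEquiv_flagCoord_ofLineProduct h hi ha hy₂ hy)
      (rowEquiv_unadaptRow_ofLineProduct h ha hy).symm).trans
      (adaptRow_unadaptRow_rowEquiv ha hy _ _)

lemma isZariskiFiberBundle_toLine (h : 1 ≤ i) (hi : i = 1 + q) :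
    IsZariskiFiberBundle (BR.toLine (i := i) (j := i) h) (BR q i) := by
  refine ⟨isRegularMap_toLine h, fun b => ?_⟩
  obtain ⟨a, ha, hba⟩ := exists_hcoord_ne_zero (b.1 ())
  have hx : ∀ x : preimageVar (BR.toLine (i := i) (j := i) h)
      {z | hcoord (z ()) a ≠ 0}, flagCoord (fstPt x.1) 1 a ≠ 0 := fun x => by
    have := x.2.2
    rwa [Set.mem_ofPred_eq, hcoord_toLine] at this
  have hinv : ∀ y : prodVar (projSpace 1 ∩ {z | hcoord (z ()) a ≠ 0}) (BR q i),
      ofLineProduct a y.1 ∈ preimageVar (BR.toLine (i := i) (j := i) h)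
        {z | hcoord (z ()) a ≠ 0} := fun y =>
    ⟨ofLineProduct_mem h hi ha y.2.2 y.2.1.2, by
      rw [fst_ofLineProduct h hi ha y.2.2 y.2.1.2]
      exact y.2.1.2⟩
  refine ⟨{z | hcoord (z ()) a ≠ 0}, isOpen_hcoord_ne_zero _ _, hba,
    { toFun := fun x => ⟨toLineProduct h q a ⟨x.1, x.2.1⟩, ⟨trivial, x.2.2⟩,
        toLineProduct_mem h hi ha ⟨x.1, x.2.1⟩ (hx x)⟩
      invFun := fun y => ⟨ofLineProduct a y.1, hinv y⟩
      left_inv := fun x => Subtype.ext (ofLineProduct_toLineProduct h hi ha ⟨x.1, x.2.1⟩ (hx x))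
      right_inv := fun y => Subtype.ext
        (toLineProduct_ofLineProduct h hi ha y.2.2 y.2.1.2 (hx ⟨_, hinv y⟩)) },
    isRegularMap_of_rowEquiv ?_, isRegularMap_of_rowEquiv ?_, fun x => rfl⟩
  · rintro (u | r | u)
    · exact ⟨_, isPolyRow_hcoord (Sum.inl ⟨1, Nat.lt_succ_of_le h⟩), fun _ => RowEquiv.refl _ _⟩
    · have hr : 1 + r < i + 1 := by omega
      refine ⟨_, isPolyRow_fibRow 1 a (Sum.inl ⟨1 + r, hr⟩), fun x => ?_⟩
      have := (isChain_fibRows_one hi ha ⟨x.1, x.2.1⟩ (hx x)).rowEquiv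
        (Nat.lt_succ_iff.mp r.2)
      rw [flagCoord_fin, fibRows, flagCoord_of_lt _ hr] at this
      exact this
    · refine ⟨_, isPolyRow_adaptRow a (Sum.inl ⟨1, Nat.lt_succ_of_le h⟩) (Sum.inr u),
        fun x => ?_⟩
      have := rowEquiv_adaptRow_toLineProduct (q := q) h ha ⟨x.1, x.2.1⟩ (hx x)
      rw [flagCoord_of_lt _ (Nat.lt_succ_of_le h)] at this
      exact this
  · rintro (k | u)
    · have hg := fun y : prodVar (projSpace 1 ∩ {z | hcoord (z ()) a ≠ 0}) (BR q i) =>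
        (isChain_glueRows_lineRows hi ha y.2.2 y.2.1.2).rowEquiv (Nat.lt_succ_iff.mp k.2)
      simp only [flagCoord_fin] at hg
      rcases Nat.eq_zero_or_pos (k : ℕ) with hk | hk
      -- The line `l_0` is the only point of `ℙ^0`, given by a constant of multidegree zero.
      · refine ⟨_, isPolyRow_one, fun y => ?_⟩
        have := hg y
        rw [glueRows, if_pos (by omega), lineRows, if_pos hk] at this
        exact this
      · refine ⟨_, isPolyRow_glueRow 1 a (Sum.inl ())
          (Sum.inr (Sum.inl ⟨k - 1, by omega⟩)), fun y => ?_⟩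
        have := hg y
        rw [glueRows, if_neg (by omega), lineRows_one, flagCoord_of_lt _ (by omega)] at this
        exact this
    · exact ⟨_, isPolyRow_unadaptRow a (Sum.inl ()) (Sum.inr (Sum.inr u)), fun y =>
        rowEquiv_unadaptRow_ofLineProduct h ha y.2.1.2⟩

end OverLine

end BuchstaberRay

theorem mainTheorem9 :
    (∀ (i j : ℕ) (_ : j + 1 ≤ i),
      BuchstaberRay.IsZariskiFiberBundle
        (BuchstaberRay.BR.toBF (i := i) (j := j) (m := i - j - 1)
          ((Nat.sub_le _ _).trans (Nat.sub_le _ _)))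
        (BuchstaberRay.BR (j + 1) j)) ∧
    (∀ (i : ℕ) (h : 1 ≤ i),
      BuchstaberRay.IsZariskiFiberBundle
        (BuchstaberRay.BR.toLine (i := i) (j := i) h)
        (BuchstaberRay.BR (i - 1) i)) :=
  ⟨fun _ _ _ => BuchstaberRay.isZariskiFiberBundle_toBF _ (by omega),
    fun _ h => BuchstaberRay.isZariskiFiberBundle_toLine h (by omega)⟩
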